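/- Write $\log x=\max\{\ln x,2\}$, where $\ln$ is the natural logarithm, and define recursively $\log_1 x=\log x$ and $\log_k x=\log(\log_{k-1}x)$ for $k\ge 2$. For a positive integer $t$ and a prime power $q$, let $N_t(q)$ be the number of irreducible polynomials over the finite field $\mathbb{F}_q$ of the form $X^t-a$ with $a\in\mathbb{F}_q^*$. **Theorem.** For all real $A>0$ and $\varepsilon>0$ there are constants $q_0$ and $T_0$, depending only on $A$ and $\varepsilon$, such that for every prime power $q\ge q_0$ and every real $T\ge T_0$ with $$T\ge \bigl(\log (q-1)\bigr)^{(1+\varepsilon)A\log_3 q/\log_4 q}$$ we have $$\sum_{1\le t\le T}N_t(q)\le \frac{(q-1)\,T}{(\log T)^A}.$$ -/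

import Mathlib

/-- The truncated logarithm `log x = max {ln x, 2}`, where `ln` is the natural logarithm. -/
noncomputable def truncLog (x : ℝ) : ℝ := max (Real.log x) 2

/-- The iterated truncated logarithm: `log_1 x = log x`, `log_{k+1} x = log (log_k x)`
(and `log_0 x = x`). -/
noncomputable def iterTruncLog : ℕ → ℝ → ℝ
  | 0, x => x
  | k + 1, x => truncLog (iterTruncLog k x)

/-- The set of irreducible binomials of the form `X ^ t - a` over `F`.
A binomial has two nonzero terms, so `a ≠ 0`. -/
def irreducibleBinomials (F : Type*) [Field F] (t : ℕ) : Set (Polynomial F) :=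
  {f | Irreducible f ∧ ∃ a : F, a ≠ 0 ∧ f = Polynomial.X ^ t - Polynomial.C a}

/-- `N_t(q)`, the number of irreducible binomials `X ^ t - a` over the field `F` of `q` elements. -/
noncomputable def numIrreducibleBinomials (F : Type*) [Field F] (t : ℕ) : ℕ :=
  (irreducibleBinomials F t).ncard

/-! If `X ^ t - a` is irreducible, every prime factor of `t` divides `n = q - 1`: otherwise `a`
would be a `p`-th power for some prime `p ∣ t`. So the sum is at most `q - 1` times the number of `t
≤ T` composed of primes dividing `n`. Rankin's trick bounds this count by `T ^ (1 - δ)` times an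
Euler product. With `y = log n` and `w = y ^ δ`, that product is at most `(1 + log y) * exp (O(w
(log w + 1)))`, by Mertens for `p ≤ y` and the radical bound for `p > y`. Weighting by `log t = ∑
Λ(d)` saves a factor `log T`, which absorbs `1 + log y` (`card_factoredNumbers_le`). Put `L = log
log y`, `u = log T / log y`, `w = L ^ c`. The saving is `T ^ δ = exp (c u log L)`, while `(log T) ^
A = exp (A (log u + L))`. As `u ≥ (1 + ε) A L / log L`, any `c > 1 / (1 + ε)` beats the main term `A
L`, and `c < 1` makes `w log w = o(L)`. -/

/-! ### Sums over primes. -/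

/-- The radical bound: the logarithms of the prime factors of `n` sum to at most `log n`. -/
theorem sum_log_primeFactors_le {n : ℕ} (hn : n ≠ 0) :
    ∑ p ∈ n.primeFactors, Real.log p ≤ Real.log n := by
  rw [← Real.log_prod (fun p hp => by exact_mod_cast (Nat.prime_of_mem_primeFactors hp).ne_zero)]
  apply Real.log_le_log
  · exact Finset.prod_pos fun p hp => by exact_mod_cast (Nat.prime_of_mem_primeFactors hp).pos
  · rw [← Nat.cast_prod]
    exact_mod_cast Nat.le_of_dvd (Nat.pos_of_ne_zero hn) (Nat.prod_primeFactors_dvd n)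

theorem log_four_le_two : Real.log 4 ≤ 2 := by
  have : Real.log 4 = 2 * Real.log 2 := by
    rw [show (4 : ℝ) = 2 ^ 2 by norm_num, Real.log_pow]; norm_num
  have := Real.log_two_lt_d9
  linarith

open Finset in
/-- The upper bound in Mertens' first theorem. -/
theorem sum_log_div_prime_le {N : ℕ} (hN : N ≠ 0) :
    ∑ p ∈ Ioc 0 N with p.Prime, Real.log p / p ≤ Real.log N + 2 := by
  have hN0 : (0 : ℝ) < N := by exact_mod_cast Nat.pos_of_ne_zero hN
  have hlow : ∑ p ∈ Ioc 0 N with p.Prime, Real.log p * ((N / p : ℕ) : ℝ) ≤ N * Real.log N := by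
    calc ∑ p ∈ Ioc 0 N with p.Prime, Real.log p * ((N / p : ℕ) : ℝ)
        = ∑ p ∈ Ioc 0 N with p.Prime, ∑ t ∈ Ioc 0 N with p ∣ t, Real.log p := by
          refine sum_congr rfl fun p _ => ?_
          rw [sum_const, Nat.Ioc_filter_dvd_card_eq_div, nsmul_eq_mul, mul_comm]
      _ = ∑ t ∈ Ioc 0 N, ∑ p ∈ t.primeFactors, Real.log p := by
          refine sum_comm' fun p t => ?_
          simp only [mem_filter, mem_Ioc, Nat.mem_primeFactors]
          constructor
          · rintro ⟨⟨_, hp⟩, ⟨h1, h2⟩, h3⟩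
            exact ⟨⟨hp, h3, h1.ne'⟩, h1, h2⟩
          · rintro ⟨⟨hp, h3, _⟩, h1, h2⟩
            exact ⟨⟨⟨hp.pos, (Nat.le_of_dvd h1 h3).trans h2⟩, hp⟩, ⟨h1, h2⟩, h3⟩
      _ ≤ ∑ t ∈ Ioc 0 N, Real.log N := by
          refine sum_le_sum fun t ht => ?_
          rw [mem_Ioc] at ht
          refine (sum_log_primeFactors_le ht.1.ne').trans (Real.log_le_log ?_ ?_)
          · exact_mod_cast ht.1
          · exact_mod_cast ht.2
      _ = N * Real.log N := by simp
  have htheta : ∑ p ∈ Ioc 0 N with p.Prime, Real.log p ≤ 2 * N := by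
    have h := Chebyshev.theta_le_log4_mul_x hN0.le
    rw [Chebyshev.theta, Nat.floor_natCast] at h
    nlinarith [log_four_le_two]
  -- Replacing `⌊N / p⌋` by `N / p` costs at most `log p` per prime, hence `θ(N)` in total.
  have hterm : N * ∑ p ∈ Ioc 0 N with p.Prime, Real.log p / p ≤
      ∑ p ∈ Ioc 0 N with p.Prime, Real.log p * ((N / p : ℕ) : ℝ) +
        ∑ p ∈ Ioc 0 N with p.Prime, Real.log p := by
    rw [mul_sum, ← sum_add_distrib]
    refine sum_le_sum fun p hp => ?_
    have hl : 0 ≤ Real.log p := Real.log_natCast_nonneg p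
    have : (N : ℝ) / p ≤ (N / p : ℕ) + 1 := by
      rw [← Nat.floor_div_eq_div (K := ℝ)]
      exact (Nat.lt_floor_add_one _).le
    calc (N : ℝ) * (Real.log p / p) = Real.log p * (N / p) := by ring
      _ ≤ Real.log p * ((N / p : ℕ) + 1) := by gcongr
      _ = _ := by ring
  have : N * ∑ p ∈ Ioc 0 N with p.Prime, Real.log p / p ≤ N * (Real.log N + 2) := by linarith
  exact le_of_mul_le_mul_left this hN0

/-! ### Euler products over the primes dividing `n`. -/

/-- `ζ(s) ≤ 1 + 1 / (s - 1)`, for finite partial sums. -/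
theorem sum_rpow_neg_le {s : ℝ} (hs : 1 < s) (S : Finset ℕ) :
    ∑ m ∈ S, (m : ℝ) ^ (-s) ≤ 1 + 1 / (s - 1) := by
  have hsum : Summable fun m : ℕ => (m : ℝ) ^ (-s) := by
    rw [Real.summable_nat_rpow]; linarith
  refine (hsum.sum_le_tsum S fun m _ => by positivity).trans ?_
  rw [hsum.tsum_eq_zero_add]
  have h := ZetaAsymptotics.zeta_limit_aux1 hs
  have hpos : 0 ≤ ZetaAsymptotics.termTSum s :=
    tsum_nonneg fun n => ZetaAsymptotics.term_nonneg _ _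
  have heq : ∑' m : ℕ, ((m + 1 : ℕ) : ℝ) ^ (-s) = ∑' n : ℕ, 1 / (n + 1 : ℝ) ^ s := by
    refine tsum_congr fun m => ?_
    rw [Real.rpow_neg (by positivity), one_div]; push_cast; rfl
  rw [heq, Nat.cast_zero, Real.zero_rpow (by linarith)]
  nlinarith

/-- The finite Euler product of `ζ` over the primes dividing `n`. -/
theorem hasSum_factoredNumbers_rpow_neg (n : ℕ) {σ : ℝ} (hσ : 0 < σ) :
    HasSum (fun m : Nat.factoredNumbers n.primeFactors => ((m : ℕ) : ℝ) ^ (-σ))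
      (∏ p ∈ n.primeFactors, (1 - (p : ℝ) ^ (-σ))⁻¹) := by
  let f : ℕ →* ℝ :=
    { toFun := fun m => (m : ℝ) ^ (-σ)
      map_one' := by simp
      map_mul' := fun a b => by
        push_cast; exact Real.mul_rpow (by positivity) (by positivity) }
  have h := (EulerProduct.summable_and_hasSum_factoredNumbers_prod_filter_prime_geometric
    (f := f) (fun {p} hp => ?_) n.primeFactors).2
  · rwa [Finset.filter_true_of_mem fun p hp => Nat.prime_of_mem_primeFactors hp] at h
  · change ‖(p : ℝ) ^ (-σ)‖ < 1
    rw [Real.norm_of_nonneg (by positivity)]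
    exact Real.rpow_lt_one_of_one_lt_of_neg (by exact_mod_cast hp.one_lt) (by linarith)

theorem sum_rpow_neg_le_prod (n : ℕ) {σ : ℝ} (hσ : 0 < σ) (S : Finset ℕ)
    (hS : ∀ m ∈ S, m ∈ Nat.factoredNumbers n.primeFactors) :
    ∑ m ∈ S, (m : ℝ) ^ (-σ) ≤ ∏ p ∈ n.primeFactors, (1 - (p : ℝ) ^ (-σ))⁻¹ := by
  rw [← Finset.sum_subtype_of_mem (fun m : ℕ => (m : ℝ) ^ (-σ)) hS]
  exact sum_le_hasSum _ (fun _ _ => by positivity) (hasSum_factoredNumbers_rpow_neg n hσ)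

theorem prod_one_sub_rpow_neg_inv_le (n : ℕ) {s : ℝ} (hs : 1 < s) :
    ∏ p ∈ n.primeFactors, (1 - (p : ℝ) ^ (-s))⁻¹ ≤ 1 + 1 / (s - 1) := by
  have h := hasSum_factoredNumbers_rpow_neg n (σ := s) (by linarith)
  refine hasSum_le_of_sum_le h fun S => ?_
  have h' := sum_rpow_neg_le hs (S.map (Function.Embedding.subtype _))
  rwa [Finset.sum_map] at h'

/-- By `1 + x ≤ exp x` it suffices that `(a - b) * (4 * (1 - a) - 1) ≥ 0`, which is where `3 / 4`
and `4` match. -/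
theorem one_sub_inv_le_mul_exp {a b : ℝ} (ha : a ≤ 3 / 4) (hba : b ≤ a) :
    (1 - a)⁻¹ ≤ (1 - b)⁻¹ * Real.exp (4 * (a - b)) := by
  have h1 : 0 < 1 - a := by linarith
  have h2 : 0 < 1 - b := by linarith
  have h3 : 1 - b ≤ (1 - a) * Real.exp (4 * (a - b)) := by
    have := Real.add_one_le_exp (4 * (a - b))
    nlinarith
  rw [inv_mul_eq_div, le_div_iff₀ h2, inv_mul_le_iff₀ h1]
  exact h3

theorem rpow_neg_le_three_quarters {p σ : ℝ} (hp : 2 ≤ p) (hσ : 1 / 2 ≤ σ) :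
    p ^ (-σ) ≤ 3 / 4 := by
  have h1 : p ^ (-σ) ≤ 2 ^ (-(1 / 2 : ℝ)) := by
    calc p ^ (-σ) ≤ 2 ^ (-σ) := Real.rpow_le_rpow_of_nonpos (by norm_num) hp (by linarith)
      _ ≤ _ := Real.rpow_le_rpow_of_exponent_le (by norm_num) (by linarith)
  refine h1.trans ?_
  rw [Real.rpow_neg (by norm_num), ← Real.sqrt_eq_rpow]
  rw [inv_le_comm₀ (by positivity) (by norm_num)]
  apply Real.le_sqrt_of_sq_le
  norm_num

/-- Moving the exponent from `1 - δ` to `1 + η` costs little for small `p`. -/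
theorem rpow_sub_rpow_le {p y δ η : ℝ} (hp : 1 ≤ p) (hpy : p ≤ y) (hδ : 0 ≤ δ) (hη : 0 ≤ η) :
    p ^ (-(1 - δ)) - p ^ (-(1 + η)) ≤ y ^ δ * (δ + η) * (Real.log p / p) := by
  have hp0 : 0 < p := by linarith
  have hl : 0 ≤ Real.log p := Real.log_nonneg hp
  have e1 : p ^ (-(1 - δ)) = p ^ δ / p := by
    rw [show -(1 - δ) = δ - 1 by ring, Real.rpow_sub_one hp0.ne']
  have e2 : p ^ (-(1 + η)) = p ^ δ / p * Real.exp (-((δ + η) * Real.log p)) := by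
    rw [← e1, Real.rpow_def_of_pos hp0, Real.rpow_def_of_pos hp0, ← Real.exp_add]
    congr 1; ring
  rw [e1, e2]
  have h := Real.add_one_le_exp (-((δ + η) * Real.log p))
  calc p ^ δ / p - p ^ δ / p * Real.exp (-((δ + η) * Real.log p))
      = p ^ δ / p * (1 - Real.exp (-((δ + η) * Real.log p))) := by ring
    _ ≤ p ^ δ / p * ((δ + η) * Real.log p) := by gcongr; linarith
    _ ≤ y ^ δ / p * ((δ + η) * Real.log p) := by gcongr
    _ = _ := by ring

/-- Inserting `log p / log y ≥ 1` prepares large primes for the radical bound. -/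
theorem rpow_neg_le_of_lt {p y δ : ℝ} (hy : 1 < y) (hpy : y < p) (hδ : δ ≤ 1) :
    p ^ (-(1 - δ)) ≤ y ^ δ / (y * Real.log y) * Real.log p := by
  have hy0 : 0 < y := by linarith
  have hl : 0 < Real.log y := Real.log_pos hy
  calc p ^ (-(1 - δ)) ≤ y ^ (-(1 - δ)) :=
        Real.rpow_le_rpow_of_nonpos hy0 hpy.le (by linarith)
    _ = y ^ δ / (y * Real.log y) * Real.log y := by
        rw [show -(1 - δ) = δ - 1 by ring, Real.rpow_sub_one hy0.ne']
        field_simp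
    _ ≤ _ := by gcongr

-- Primes up to `y` are summed by Mertens, those beyond `y` by `∑ log p ≤ log n = y`.
open Finset in
theorem sum_primeFactors_rpow_sub_le {n : ℕ} (hn : n ≠ 0) {y δ : ℝ} (hy : y = Real.log n)
    (hl : 1 ≤ Real.log y) (hδ0 : 0 ≤ δ) (hδ : δ ≤ 1) :
    ∑ p ∈ n.primeFactors, ((p : ℝ) ^ (-(1 - δ)) - (p : ℝ) ^ (-(1 + 1 / Real.log y))) ≤
      4 * (y ^ δ * (Real.log (y ^ δ) + 1)) := by
  have hy0' : 0 ≤ y := by rw [hy]; exact Real.log_natCast_nonneg n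
  have hy1 : 1 < y := by
    by_contra h
    have := Real.log_nonpos hy0' (not_lt.mp h)
    linarith
  have hy0 : 0 < y := by linarith
  set ℓ := Real.log y with hℓ
  have hℓ0 : 0 < ℓ := by linarith
  set w := y ^ δ with hw
  have hw0 : 0 < w := Real.rpow_pos_of_pos hy0 _
  have hw1 : Real.log w = δ * ℓ := Real.log_rpow hy0 _
  have hfl : ⌊y⌋₊ ≠ 0 := (Nat.floor_pos.mpr hy1.le).ne'
  have hterm : ∀ p ∈ n.primeFactors,
      (p : ℝ) ^ (-(1 - δ)) - (p : ℝ) ^ (-(1 + 1 / ℓ)) ≤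
        (if (p : ℝ) ≤ y then w * (δ + 1 / ℓ) * (Real.log p / p) else 0) +
          w / (y * ℓ) * Real.log p := by
    intro p hp
    have hp1 : (1 : ℝ) ≤ p := by exact_mod_cast (Nat.prime_of_mem_primeFactors hp).one_lt.le
    have hlp : 0 ≤ Real.log p := Real.log_nonneg hp1
    split_ifs with h
    · have := rpow_sub_rpow_le hp1 h hδ0 (η := 1 / ℓ) (by positivity)
      have : 0 ≤ w / (y * ℓ) * Real.log p := by positivity
      linarith
    · have := rpow_neg_le_of_lt hy1 (not_le.mp h) hδ
      have : 0 ≤ (p : ℝ) ^ (-(1 + 1 / ℓ)) := by positivity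
      linarith
  refine (sum_le_sum hterm).trans ?_
  rw [sum_add_distrib, ← mul_sum, ← sum_filter, ← mul_sum]
  have hA : ∑ p ∈ n.primeFactors with ((p : ℕ) : ℝ) ≤ y, Real.log p / p ≤ ℓ + 2 := by
    calc ∑ p ∈ n.primeFactors with ((p : ℕ) : ℝ) ≤ y, Real.log p / p
        ≤ ∑ p ∈ Ioc 0 ⌊y⌋₊ with p.Prime, Real.log p / p := by
          refine sum_le_sum_of_subset_of_nonneg (fun p hp => ?_) fun p _ _ =>
            div_nonneg (Real.log_natCast_nonneg p) (by positivity)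
          rw [mem_filter] at hp
          have hpp := Nat.prime_of_mem_primeFactors hp.1
          rw [mem_filter, mem_Ioc]
          exact ⟨⟨hpp.pos, Nat.le_floor hp.2⟩, hpp⟩
      _ ≤ Real.log ⌊y⌋₊ + 2 := sum_log_div_prime_le hfl
      _ ≤ ℓ + 2 := by
          have := Real.log_le_log (by exact_mod_cast Nat.pos_of_ne_zero hfl) (Nat.floor_le hy0')
          linarith
  have hB : ∑ p ∈ n.primeFactors, Real.log p ≤ y := hy ▸ sum_log_primeFactors_le hn
  have hδℓ : 0 ≤ δ * ℓ := by positivity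
  calc w * (δ + 1 / ℓ) * ∑ p ∈ n.primeFactors with ((p : ℕ) : ℝ) ≤ y, Real.log p / p +
        w / (y * ℓ) * ∑ p ∈ n.primeFactors, Real.log p
      ≤ w * (δ + 1 / ℓ) * (3 * ℓ) + w / (y * ℓ) * y := by
        gcongr
        linarith
    _ = w * (3 * (δ * ℓ + 1) + 1 / ℓ) := by field_simp
    _ ≤ w * (3 * (δ * ℓ + 1) + 1) := by
        gcongr
        rw [div_le_one hℓ0]; exact hl
    _ ≤ 4 * (w * (Real.log w + 1)) := by
        rw [hw1]; nlinarith [mul_nonneg hw0.le hδℓ]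

/-- A bound for the Euler product over the primes dividing `n`, to the left of `1`. -/
theorem prod_primeFactors_inv_le {n : ℕ} (hn : n ≠ 0) {y δ : ℝ} (hy : y = Real.log n)
    (hl : 1 ≤ Real.log y) (hδ0 : 0 ≤ δ) (hδ : δ ≤ 1 / 2) :
    ∏ p ∈ n.primeFactors, (1 - (p : ℝ) ^ (-(1 - δ)))⁻¹ ≤
      (1 + Real.log y) * Real.exp (16 * (y ^ δ * (Real.log (y ^ δ) + 1))) := by
  -- At the comparison exponent `1 + 1 / log y` the zeta bound is exactly `1 + log y`.
  have hs : 1 < 1 + 1 / Real.log y := by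
    have : 0 < 1 / Real.log y := by positivity
    linarith
  calc ∏ p ∈ n.primeFactors, (1 - (p : ℝ) ^ (-(1 - δ)))⁻¹
      ≤ ∏ p ∈ n.primeFactors, ((1 - (p : ℝ) ^ (-(1 + 1 / Real.log y)))⁻¹ *
          Real.exp (4 * ((p : ℝ) ^ (-(1 - δ)) - (p : ℝ) ^ (-(1 + 1 / Real.log y))))) := by
        refine Finset.prod_le_prod (fun p hp => ?_) fun p hp => ?_
        all_goals
          have hp2 : (2 : ℝ) ≤ p := by
            exact_mod_cast (Nat.prime_of_mem_primeFactors hp).two_le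
          have h34 := rpow_neg_le_three_quarters hp2 (σ := 1 - δ) (by linarith)
        · exact inv_nonneg.mpr (by linarith)
        · exact one_sub_inv_le_mul_exp h34
            (Real.rpow_le_rpow_of_exponent_le (by linarith) (by linarith))
    _ = (∏ p ∈ n.primeFactors, (1 - (p : ℝ) ^ (-(1 + 1 / Real.log y)))⁻¹) *
          Real.exp (4 * ∑ p ∈ n.primeFactors,
            ((p : ℝ) ^ (-(1 - δ)) - (p : ℝ) ^ (-(1 + 1 / Real.log y)))) := by
        rw [Finset.prod_mul_distrib, Finset.mul_sum, Real.exp_sum]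
    _ ≤ _ := by
        have h1 := prod_one_sub_rpow_neg_inv_le n hs
        have h2 := sum_primeFactors_rpow_sub_le hn hy hl hδ0 (by linarith)
        rw [add_sub_cancel_left, one_div_one_div] at h1
        refine mul_le_mul h1 (Real.exp_le_exp.mpr (by linarith)) (Real.exp_pos _).le ?_
        linarith

/-! ### Rankin's bound with a logarithmic saving. -/

theorem mem_primeFactors_of_prime_of_mem_factoredNumbers {n p : ℕ} (hp : p.Prime)
    (h : p ∈ Nat.factoredNumbers n.primeFactors) : p ∈ n.primeFactors :=
  Nat.mem_factoredNumbers'.mp h p hp dvd_rfl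

open Finset in
open scoped ArithmeticFunction.vonMangoldt in
open Classical in
/-- Chebyshev's bound for prime powers built from the primes dividing `n`. -/
theorem sum_vonMangoldt_factoredNumbers_le {n : ℕ} (hn : n ≠ 0) {y δ z : ℝ}
    (hy : y = Real.log n) (hy1 : 1 ≤ y) (hδ0 : 0 ≤ δ) (hδ : δ ≤ 1 / 4) (hz : 1 ≤ z) :
    ∑ d ∈ Ioc 0 ⌊z⌋₊ with d ∈ Nat.factoredNumbers n.primeFactors, Λ d ≤
      10 * (y ^ δ * z ^ (1 - δ)) := by
  have hz0 : 0 < z := by linarith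
  have hy0 : 0 < y := by linarith
  have hw1 : 1 ≤ y ^ δ := Real.one_le_rpow hy1 hδ0
  have hzσ : 0 < z ^ (1 - δ) := by positivity
  have hsplit : ∑ d ∈ Ioc 0 ⌊z⌋₊ with d ∈ Nat.factoredNumbers n.primeFactors, Λ d ≤
      (∑ p ∈ Ioc 0 ⌊z⌋₊ with p.Prime ∧ p ∈ n.primeFactors, Real.log p) +
        (Chebyshev.psi z - Chebyshev.theta z) := by
    rw [Chebyshev.psi_sub_theta_eq_sum_not_prime,
      ← sum_filter_add_sum_filter_not _ (fun d : ℕ => d.Prime)]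
    refine add_le_add ?_ ?_
    · rw [filter_filter]
      refine (sum_le_sum_of_subset_of_nonneg (fun p hp => ?_) fun _ _ _ =>
        ArithmeticFunction.vonMangoldt_nonneg).trans_eq (sum_congr rfl fun p hp => ?_)
      · rw [mem_filter] at hp ⊢
        exact ⟨hp.1, hp.2.2, mem_primeFactors_of_prime_of_mem_factoredNumbers hp.2.2 hp.2.1⟩
      · rw [mem_filter] at hp
        exact ArithmeticFunction.vonMangoldt_apply_prime hp.2.1
    · refine sum_le_sum_of_subset_of_nonneg (fun p hp => ?_) fun _ _ _ =>
        ArithmeticFunction.vonMangoldt_nonneg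
      simp only [mem_filter] at hp ⊢
      exact ⟨hp.1.1, hp.2⟩
  have hprime1 : ∑ p ∈ Ioc 0 ⌊z⌋₊ with p.Prime ∧ p ∈ n.primeFactors, Real.log p ≤ 2 * z := by
    have h := Chebyshev.theta_le_log4_mul_x hz0.le
    have h' : ∑ p ∈ Ioc 0 ⌊z⌋₊ with p.Prime ∧ p ∈ n.primeFactors, Real.log p ≤
        Chebyshev.theta z := by
      refine sum_le_sum_of_subset_of_nonneg (fun p hp => ?_) fun p _ _ =>
        Real.log_natCast_nonneg p
      rw [mem_filter] at hp ⊢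
      exact ⟨hp.1, hp.2.1⟩
    nlinarith [log_four_le_two]
  have hprime2 : ∑ p ∈ Ioc 0 ⌊z⌋₊ with p.Prime ∧ p ∈ n.primeFactors, Real.log p ≤ y := by
    rw [hy]
    refine le_trans ?_ (sum_log_primeFactors_le hn)
    refine sum_le_sum_of_subset_of_nonneg (fun p hp => ?_) fun p _ _ => Real.log_natCast_nonneg p
    exact (mem_filter.mp hp).2.2
  -- The bounds `2 * z` and `y` are interpolated: `min y z ≤ y ^ δ * z ^ (1 - δ)`.
  have hprime : ∑ p ∈ Ioc 0 ⌊z⌋₊ with p.Prime ∧ p ∈ n.primeFactors, Real.log p ≤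
      2 * (y ^ δ * z ^ (1 - δ)) := by
    rcases le_total z y with h | h
    · have : z ≤ y ^ δ * z ^ (1 - δ) := by
        calc z = z ^ δ * z ^ (1 - δ) := by
              rw [← Real.rpow_add hz0, add_sub_cancel, Real.rpow_one]
          _ ≤ _ := by gcongr
      linarith
    · have : y ≤ y ^ δ * z ^ (1 - δ) := by
        calc y = y ^ δ * y ^ (1 - δ) := by
              rw [← Real.rpow_add hy0, add_sub_cancel, Real.rpow_one]
          _ ≤ _ := by gcongr; linarith
      linarith
  -- Higher prime powers contribute `O(z ^ (3 / 4))`, hence the restriction `δ ≤ 1 / 4`.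
  have hpow : Chebyshev.psi z - Chebyshev.theta z ≤ 8 * (y ^ δ * z ^ (1 - δ)) := by
    have hlog : Real.log z ≤ 4 * z ^ (1 / 4 : ℝ) := by
      have := Real.log_le_rpow_div hz0.le (ε := 1 / 4) (by norm_num)
      linarith
    calc Chebyshev.psi z - Chebyshev.theta z ≤ 2 * √z * Real.log z :=
          Chebyshev.psi_sub_theta_le hz
      _ ≤ 2 * √z * (4 * z ^ (1 / 4 : ℝ)) := by gcongr
      _ = 8 * z ^ (3 / 4 : ℝ) := by
          rw [Real.sqrt_eq_rpow, show (3 / 4 : ℝ) = 1 / 2 + 1 / 4 by norm_num,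
            Real.rpow_add hz0]
          ring
      _ ≤ 8 * z ^ (1 - δ) := by
          gcongr
          linarith
      _ ≤ 8 * (y ^ δ * z ^ (1 - δ)) := by nlinarith
  linarith

open Finset in
open scoped ArithmeticFunction.vonMangoldt in
open Classical in
/-- Summing `log = Λ * 1` over the `s`-factored numbers up to `N`. -/
theorem sum_log_factoredNumbers_le (s : Finset ℕ) (N : ℕ) :
    ∑ t ∈ Ioc 0 N with t ∈ Nat.factoredNumbers s, Real.log t ≤
      ∑ m ∈ Ioc 0 N with m ∈ Nat.factoredNumbers s,
        ∑ d ∈ Ioc 0 (N / m) with d ∈ Nat.factoredNumbers s, Λ d := by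
  calc ∑ t ∈ Ioc 0 N with t ∈ Nat.factoredNumbers s, Real.log t
      = ∑ t ∈ Ioc 0 N with t ∈ Nat.factoredNumbers s, ∑ m ∈ t.divisors, Λ (t / m) := by
        refine sum_congr rfl fun t _ => ?_
        rw [← ArithmeticFunction.vonMangoldt_sum, Nat.sum_div_divisors]
    _ = ∑ m ∈ Ioc 0 N with m ∈ Nat.factoredNumbers s,
          ∑ t ∈ Ioc 0 N with t ∈ Nat.factoredNumbers s ∧ m ∣ t, Λ (t / m) := by
        refine sum_comm' fun t m => ?_
        simp only [mem_filter, mem_Ioc, Nat.mem_divisors]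
        constructor
        · rintro ⟨⟨⟨h1, h2⟩, h3⟩, h4, h5⟩
          exact ⟨⟨⟨h1, h2⟩, h3, h4⟩, ⟨Nat.pos_of_dvd_of_pos h4 h1, (Nat.le_of_dvd h1 h4).trans h2⟩,
            Nat.mem_factoredNumbers_of_dvd h3 h4⟩
        · rintro ⟨⟨⟨h1, h2⟩, h3, h4⟩, -, -⟩
          exact ⟨⟨⟨h1, h2⟩, h3⟩, h4, h1.ne'⟩
    _ ≤ _ := by
        refine sum_le_sum fun m hm => ?_
        rw [mem_filter, mem_Ioc] at hm
        have hinj : Set.InjOn (fun t => t / m)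
            (({t ∈ Ioc 0 N | t ∈ Nat.factoredNumbers s ∧ m ∣ t} : Finset ℕ) : Set ℕ) := by
          intro a ha b hb hab
          rw [mem_coe, mem_filter] at ha hb
          exact (Nat.div_left_inj ha.2.2 hb.2.2).mp hab
        rw [← sum_image (f := fun d => Λ d) hinj]
        refine sum_le_sum_of_subset_of_nonneg (fun d hd => ?_) fun _ _ _ =>
          ArithmeticFunction.vonMangoldt_nonneg
        obtain ⟨t, ht, rfl⟩ := mem_image.mp hd
        rw [mem_filter, mem_Ioc] at ht ⊢
        exact ⟨⟨Nat.div_pos (Nat.le_of_dvd ht.1.1 ht.2.2) hm.1.1, Nat.div_le_div_right ht.1.2⟩,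
          Nat.mem_factoredNumbers_of_dvd ht.2.1 (Nat.div_dvd_of_dvd ht.2.2)⟩

open Finset in
open Classical in
/-- Rankin's bound, sharpened by a factor `log T`, for the number of integers up to `T` all of
whose prime factors divide `n`. -/
theorem card_factoredNumbers_mul_log_le {n : ℕ} (hn : n ≠ 0) {y δ T : ℝ}
    (hy : y = Real.log n) (hy1 : 1 ≤ y) (hδ0 : 0 ≤ δ) (hδ : δ ≤ 1 / 4) (hT : 1 ≤ T) :
    (#{t ∈ Ioc 0 ⌊T⌋₊ | t ∈ Nat.factoredNumbers n.primeFactors} : ℝ) * Real.log T ≤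
      12 * (y ^ δ * T ^ (1 - δ)) * ∏ p ∈ n.primeFactors, (1 - (p : ℝ) ^ (-(1 - δ)))⁻¹ := by
  have hT0 : 0 < T := by linarith
  have hw1 : 1 ≤ y ^ δ := Real.one_le_rpow hy1 hδ0
  set S := {t ∈ Ioc 0 ⌊T⌋₊ | t ∈ Nat.factoredNumbers n.primeFactors} with hS
  have hmem : ∀ m ∈ S, (0 : ℝ) < m ∧ (m : ℝ) ≤ T := fun m hm => by
    rw [hS, mem_filter, mem_Ioc] at hm
    exact ⟨by exact_mod_cast hm.1.1, (Nat.le_floor_iff hT0.le).mp hm.1.2⟩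
  -- Write `log T = log t + log (T / t)`; the two parts give the constants `10` and `2`.
  have h1 : ∑ t ∈ S, Real.log t ≤ ∑ m ∈ S, 10 * (y ^ δ * (T / m) ^ (1 - δ)) := by
    refine (sum_log_factoredNumbers_le _ _).trans (sum_le_sum fun m hm => ?_)
    rw [← Nat.floor_div_natCast]
    obtain ⟨hm0, hmT⟩ := hmem m hm
    exact sum_vonMangoldt_factoredNumbers_le hn hy hy1 hδ0 hδ ((one_le_div hm0).mpr hmT)
  have h2 : ∑ t ∈ S, (Real.log T - Real.log t) ≤ ∑ m ∈ S, 2 * (y ^ δ * (T / m) ^ (1 - δ)) := by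
    refine sum_le_sum fun m hm => ?_
    obtain ⟨hm0, hmT⟩ := hmem m hm
    rw [← Real.log_div hT0.ne' hm0.ne']
    have hp : 0 ≤ (T / m) ^ (1 - δ) := by positivity
    calc Real.log (T / m) ≤ (T / m) ^ (1 - δ) / (1 - δ) :=
          Real.log_le_rpow_div (by positivity) (by linarith)
      _ ≤ 2 * (T / m) ^ (1 - δ) := by
          rw [div_le_iff₀ (by linarith)]; nlinarith
      _ ≤ _ := by nlinarith
  have h3 : ∑ m ∈ S, (T / m) ^ (1 - δ) ≤
      T ^ (1 - δ) * ∏ p ∈ n.primeFactors, (1 - (p : ℝ) ^ (-(1 - δ)))⁻¹ := by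
    calc ∑ m ∈ S, (T / m) ^ (1 - δ) = T ^ (1 - δ) * ∑ m ∈ S, (m : ℝ) ^ (-(1 - δ)) := by
          rw [mul_sum]
          refine sum_congr rfl fun m hm => ?_
          rw [Real.div_rpow hT0.le (hmem m hm).1.le, Real.rpow_neg (hmem m hm).1.le, div_eq_mul_inv]
      _ ≤ _ := by
          gcongr
          exact sum_rpow_neg_le_prod n (by linarith) S fun m hm => (mem_filter.mp hm).2
  rw [← mul_sum, ← mul_sum] at h1 h2
  rw [sum_sub_distrib, sum_const, nsmul_eq_mul] at h2
  have h4 := mul_le_mul_of_nonneg_left h3 (zero_le_one.trans hw1)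
  linarith

-- Since `y ≤ T`, the factor `1 + log y` is at most `2 * log T` and cancels; the remaining `24 * w`
-- costs `5` in the exponent, on top of `16`.
open Finset in
open Classical in
theorem card_factoredNumbers_le {n : ℕ} (hn : n ≠ 0) {y δ T : ℝ}
    (hy : y = Real.log n) (hl : 1 ≤ Real.log y) (hδ0 : 0 ≤ δ) (hδ : δ ≤ 1 / 4) (hT : y ≤ T) :
    (#{t ∈ Ioc 0 ⌊T⌋₊ | t ∈ Nat.factoredNumbers n.primeFactors} : ℝ) ≤
      T ^ (1 - δ) * Real.exp (21 * (y ^ δ * (Real.log (y ^ δ) + 1))) := by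
  have hy0' : 0 ≤ y := by rw [hy]; exact Real.log_natCast_nonneg n
  have hy1 : 1 < y := by
    by_contra h
    have := Real.log_nonpos hy0' (not_lt.mp h)
    linarith
  have hy0 : 0 < y := by linarith
  have hT0 : 0 < T := by linarith
  have hlT : Real.log y ≤ Real.log T := Real.log_le_log hy0 hT
  have h1 := card_factoredNumbers_mul_log_le hn hy hy1.le hδ0 hδ (hy1.le.trans hT)
  have h2 := prod_primeFactors_inv_le hn hy hl hδ0 (by linarith)
  set w := y ^ δ with hw
  have hw1 : 1 ≤ w := Real.one_le_rpow hy1.le hδ0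
  have hw0 : 0 < w := by linarith
  have hlw : 0 ≤ Real.log w := Real.log_nonneg hw1
  set E := w * (Real.log w + 1) with hE
  have hEw : w ≤ E := by rw [hE]; nlinarith
  have h24 : 24 * w ≤ Real.exp (5 * E) := by
    have e1 : (24 : ℝ) ≤ Real.exp 4 := by
      have := Real.exp_one_gt_d9
      have h4 : Real.exp 4 = Real.exp 1 ^ 4 := by rw [← Real.exp_nat_mul]; norm_num
      rw [h4]
      calc (24 : ℝ) ≤ 2.7 ^ 4 := by norm_num
        _ ≤ _ := by gcongr; linarith
    have e2 : w ≤ Real.exp w := by linarith [Real.add_one_le_exp w]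
    calc 24 * w ≤ Real.exp 4 * Real.exp w := by gcongr
      _ = Real.exp (4 + w) := (Real.exp_add _ _).symm
      _ ≤ _ := Real.exp_le_exp.mpr (by linarith)
  have hTσ : 0 < T ^ (1 - δ) := by positivity
  have hlT0 : 0 < Real.log T := by linarith
  refine le_of_mul_le_mul_right ?_ hlT0
  calc _ ≤ _ := h1
    _ ≤ 12 * (w * T ^ (1 - δ)) * ((1 + Real.log y) * Real.exp (16 * E)) := by gcongr
    _ ≤ 12 * (w * T ^ (1 - δ)) * ((2 * Real.log T) * Real.exp (16 * E)) := by
        gcongr; linarith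
    _ = T ^ (1 - δ) * (24 * w * Real.exp (16 * E)) * Real.log T := by ring
    _ ≤ T ^ (1 - δ) * (Real.exp (5 * E) * Real.exp (16 * E)) * Real.log T := by gcongr
    _ = _ := by rw [← Real.exp_add]; ring_nf

/-! ### Irreducible binomials. -/

/-- If `X ^ t - a` is irreducible over a finite field `F`, every prime dividing `t` divides
`|F| - 1`. -/
theorem mem_factoredNumbers_of_irreducible {F : Type*} [Field F] [Finite F] {t : ℕ}
    {a : F} (ha : a ≠ 0) (h : Irreducible (Polynomial.X ^ t - Polynomial.C a)) :
    t ∈ Nat.factoredNumbers (Nat.card F - 1).primeFactors := by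
  have hq : 1 < Nat.card F := Finite.one_lt_card
  rw [Nat.mem_factoredNumbers']
  intro p hp hpt
  rw [Nat.mem_primeFactors]
  refine ⟨hp, ?_, by omega⟩
  by_contra hpq
  -- When `p ∤ |Fˣ|`, the `p`-th power map permutes `Fˣ`, so `a = b ^ p`.
  have hcop : (Nat.card Fˣ).Coprime p := by
    rw [Nat.card_units]
    exact ((Nat.Prime.coprime_iff_not_dvd hp).mpr hpq).symm
  obtain ⟨b, hb⟩ := (powCoprime hcop).surjective (Units.mk0 a ha)
  refine pow_ne_of_irreducible_X_pow_sub_C h hpt hp.ne_one (b : F) ?_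
  have := congrArg Units.val hb
  simpa using this

theorem numIrreducibleBinomials_le {F : Type*} [Field F] [Finite F] (t : ℕ) :
    numIrreducibleBinomials F t ≤ Nat.card F - 1 := by
  have hsub : irreducibleBinomials F t ⊆
      (fun a : Fˣ => (Polynomial.X ^ t - Polynomial.C (a : F) : Polynomial F)) '' Set.univ := by
    rintro f ⟨-, a, ha, rfl⟩
    exact ⟨Units.mk0 a ha, Set.mem_univ _, rfl⟩
  calc numIrreducibleBinomials F t ≤ _ := Set.ncard_le_ncard hsub (Set.toFinite _)
    _ ≤ (Set.univ : Set Fˣ).ncard := Set.ncard_image_le (Set.toFinite _)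
    _ = Nat.card F - 1 := by rw [Set.ncard_univ, Nat.card_units]

open Finset in
open Classical in
theorem sum_numIrreducibleBinomials_le {F : Type*} [Field F] [Finite F] (N : ℕ) :
    ∑ t ∈ Icc 1 N, (numIrreducibleBinomials F t : ℝ) ≤
      ((Nat.card F : ℝ) - 1) *
        #{t ∈ Ioc 0 N | t ∈ Nat.factoredNumbers (Nat.card F - 1).primeFactors} := by
  have hq : 1 < Nat.card F := Finite.one_lt_card
  have hcast : ((Nat.card F - 1 : ℕ) : ℝ) = (Nat.card F : ℝ) - 1 := by
    rw [Nat.cast_sub hq.le, Nat.cast_one]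
  calc ∑ t ∈ Icc 1 N, (numIrreducibleBinomials F t : ℝ)
      ≤ ∑ t ∈ Ioc 0 N, if t ∈ Nat.factoredNumbers (Nat.card F - 1).primeFactors
          then (Nat.card F : ℝ) - 1 else 0 := by
        refine sum_le_sum fun t _ => ?_
        split_ifs with h
        · rw [← hcast]
          exact_mod_cast numIrreducibleBinomials_le t
        · have : irreducibleBinomials F t = ∅ := by
            refine Set.eq_empty_of_forall_notMem ?_
            rintro f ⟨hf, a, ha, rfl⟩
            exact h (mem_factoredNumbers_of_irreducible ha hf)
          simp [numIrreducibleBinomials, this]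
    _ = _ := by rw [← sum_filter, sum_const, nsmul_eq_mul, mul_comm]

/-! ### Choice of parameters and conclusion. -/

open Filter Real in
/-- The comparison of exponents behind the choice `y ^ δ = L ^ c` in Rankin's bound. -/
theorem eventually_exponent_le (A ε : ℝ) (hA : 0 < A) (hε : 0 < ε) :
    ∃ c : ℝ, 0 < c ∧ c < 1 ∧ ∀ᶠ L : ℝ in atTop, ∀ u : ℝ, (1 + ε) * A * (L / log L) ≤ u →
      1 ≤ u ∧ 21 * (L ^ c * (log (L ^ c) + 1)) + A * (log u + L) ≤ u * log (L ^ c) := by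
  have hr : 0 < 1 + ε := by linarith
  -- Then `c * (1 + ε) = (1 + ε / 4) + ε / 4`: the first part pays for `(1 + ε / 4) * A * L`, the
  -- second for `A * log u`.
  set c := (1 + ε / 2) / (1 + ε) with hc
  have hc0 : 0 < c := by positivity
  have hc1 : c < 1 := by rw [hc, div_lt_one hr]; linarith
  refine ⟨c, hc0, hc1, ?_⟩
  -- Chosen so that `42 * k = ε / 4 * A`.
  set k := ε * A / 168 with hk
  have hk0 : 0 < k := by positivity
  have h1 : ∀ᶠ L : ℝ in atTop, log L ≤ k * L ^ (1 - c) := by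
    filter_upwards [(isLittleO_log_rpow_atTop (by linarith : 0 < 1 - c)).bound hk0,
      eventually_ge_atTop 0] with L h hL
    rw [Real.norm_eq_abs, Real.norm_of_nonneg (by positivity)] at h
    exact (le_abs_self _).trans h
  have h2 : ∀ᶠ L : ℝ in atTop, 1 / k ≤ L ^ (1 - c) :=
    (tendsto_rpow_atTop (by linarith : 0 < 1 - c)).eventually_ge_atTop _
  have h3 : ∀ᶠ L : ℝ in atTop, 4 * A * (1 + ε) / ε ≤ log L :=
    tendsto_log_atTop.eventually_ge_atTop _
  have h4 : ∀ᶠ L : ℝ in atTop, log L ≤ ((1 + ε) * A) * L := by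
    filter_upwards [isLittleO_log_id_atTop.bound (by positivity : 0 < (1 + ε) * A),
      eventually_ge_atTop 0] with L h hL
    rw [Real.norm_eq_abs, id, Real.norm_of_nonneg hL] at h
    exact (le_abs_self _).trans h
  filter_upwards [h1, h2, h3, h4, eventually_gt_atTop 1] with L h1 h2 h3 h4 hL u hu
  have hL0 : 0 < L := by linarith
  have hl0 : 0 < log L := log_pos hL
  have hu1 : 1 ≤ u := by
    refine le_trans ?_ hu
    rw [← mul_div_assoc, one_le_div hl0]
    exact h4
  refine ⟨hu1, ?_⟩
  have hu0 : 0 < u := by linarith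
  rw [log_rpow hL0]
  have hP : 21 * (L ^ c * (c * log L + 1)) ≤ ε / 4 * A * L := by
    have hone : 1 ≤ k * L ^ (1 - c) := by
      rwa [div_le_iff₀ hk0, mul_comm] at h2
    have hcl : c * log L + 1 ≤ 2 * k * L ^ (1 - c) := by nlinarith
    calc 21 * (L ^ c * (c * log L + 1)) ≤ 21 * (L ^ c * (2 * k * L ^ (1 - c))) := by gcongr
      _ = 42 * k * (L ^ c * L ^ (1 - c)) := by ring
      _ = ε / 4 * A * L := by
          rw [← rpow_add hL0, add_sub_cancel, rpow_one, hk]; ring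
  have hQ : A * log u ≤ ε / 4 / (1 + ε) * log L * u := by
    have hlogu : log u ≤ u := (log_le_sub_one_of_pos hu0).trans (by linarith)
    have hAl : A ≤ ε / 4 / (1 + ε) * log L := by
      rw [div_le_iff₀ hε] at h3
      rw [div_mul_eq_mul_div, le_div_iff₀ hr]
      linarith
    calc A * log u ≤ A * u := by gcongr
      _ ≤ _ := by gcongr
  have hR : (1 + ε / 4) * A * L ≤ (1 + ε / 4) / (1 + ε) * log L * u := by
    calc (1 + ε / 4) * A * L
        = (1 + ε / 4) / (1 + ε) * log L * ((1 + ε) * A * (L / log L)) := by field_simp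
      _ ≤ _ := by gcongr
  have hsum : u * (c * log L) = (1 + ε / 4) / (1 + ε) * log L * u +
      ε / 4 / (1 + ε) * log L * u := by
    rw [hc]; field_simp; ring
  rw [hsum]
  linarith

theorem log_le_truncLog (x : ℝ) : Real.log x ≤ truncLog x := le_max_left _ _

theorem truncLog_eq_log {x : ℝ} (h : 2 ≤ Real.log x) : truncLog x = Real.log x := max_eq_left h

open Real in
/-- The iterated truncated logarithms of `q` give at least the quotient expected from
`L = ln ln ln (q - 1)`. -/
theorem div_log_le_iterTruncLog {q L : ℝ} (hq : 1 < q)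
    (h1 : 1 ≤ log (q - 1)) (h2 : 1 ≤ log (log (q - 1))) (hL : L = log (log (log (q - 1))))
    (hL2 : exp 2 ≤ L) :
    L / log L ≤ iterTruncLog 3 q / iterTruncLog 4 q := by
  have e1 : log (q - 1) ≤ iterTruncLog 1 q :=
    (log_le_log (by linarith) (sub_le_self q zero_le_one)).trans (log_le_truncLog _)
  have e2 : log (log (q - 1)) ≤ iterTruncLog 2 q :=
    (log_le_log (by linarith) e1).trans (log_le_truncLog _)
  have e3 : L ≤ iterTruncLog 3 q :=
    hL ▸ (log_le_log (by linarith) e2).trans (log_le_truncLog _)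
  have hlog : ∀ {x : ℝ}, exp 2 ≤ x → 2 ≤ log x := fun {x} hx =>
    (le_log_iff_exp_le ((exp_pos 2).trans_le hx)).mpr hx
  have e4 : iterTruncLog 4 q = log (iterTruncLog 3 q) := truncLog_eq_log (hlog (hL2.trans e3))
  rw [e4]
  have he : exp 1 ≤ exp 2 := exp_le_exp.mpr (by norm_num)
  -- `x / log x` increases for `x ≥ e`, so enlarging `L` to `log_3 q` is harmless.
  have hanti := log_div_self_antitoneOn (Set.mem_Ici.mpr (he.trans hL2))
    (Set.mem_Ici.mpr (he.trans (hL2.trans e3))) e3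
  have hl3 := hlog (hL2.trans e3)
  have hlL := hlog hL2
  have hL0 : 0 < L := (exp_pos 2).trans_le hL2
  rw [← one_div_div (log L), ← one_div_div (log (iterTruncLog 3 q))]
  exact one_div_le_one_div_of_le (div_pos (by linarith) (by linarith)) hanti

open Filter in
theorem theorem3 (A ε : ℝ) (hA : 0 < A) (hε : 0 < ε) :
    ∃ q₀ T₀ : ℝ, ∀ (F : Type*) [Field F] [Finite F] (q : ℕ) (T : ℝ),
      Nat.card F = q → q₀ ≤ (q : ℝ) → T₀ ≤ T →
      (truncLog ((q : ℝ) - 1)) ^ ((1 + ε) * A * iterTruncLog 3 q / iterTruncLog 4 q) ≤ T →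
      ∑ t ∈ Finset.Icc 1 ⌊T⌋₊, (numIrreducibleBinomials F t : ℝ) ≤
        ((q : ℝ) - 1) * T / (truncLog T) ^ A := by
  classical
  obtain ⟨c, hc0, hc1, hev⟩ := eventually_exponent_le A ε hA hε
  have hquarter : ∀ᶠ L : ℝ in atTop, 4 * L ≤ Real.exp L := by
    filter_upwards [(Real.isLittleO_pow_exp_atTop (n := 1)).bound (by norm_num : (0 : ℝ) < 1 / 4),
      eventually_ge_atTop 0] with L h hL
    rw [pow_one, Real.norm_of_nonneg hL, Real.norm_of_nonneg (Real.exp_pos L).le] at h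
    linarith
  have htl := Real.tendsto_log_atTop
  have hx : ∀ᶠ x : ℝ in atTop, _ :=
    ((htl.comp (htl.comp htl)).eventually
      (hev.and (hquarter.and (eventually_ge_atTop (Real.exp 2))))).and
    ((htl.eventually_ge_atTop 1).and ((htl.comp htl).eventually_ge_atTop 1))
  obtain ⟨x₀, hx₀⟩ := eventually_atTop.mp hx
  -- `T₀ = 0` suffices: for large `q` the lower bound on `T` already forces `T ≥ y` and `log T ≥ 2`.
  refine ⟨x₀ + 1, 0, ?_⟩
  intro F _ _ q T hcard hq _ hT
  obtain ⟨⟨hexp, hquart, hL2⟩, hy1, hl1⟩ := hx₀ ((q : ℝ) - 1) (by linarith)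
  simp only [Function.comp_apply] at hexp hquart hL2 hl1
  have hq1 : 1 < q := hcard ▸ Finite.one_lt_card
  have hqR : (1 : ℝ) < q := by exact_mod_cast hq1
  have hcast : ((q - 1 : ℕ) : ℝ) = (q : ℝ) - 1 := by
    rw [Nat.cast_sub hq1.le, Nat.cast_one]
  have hdiv := div_log_le_iterTruncLog hqR hy1 hl1 rfl hL2
  set y := Real.log ((q : ℝ) - 1) with hy
  set L := Real.log (Real.log y) with hL
  have hy0 : 0 < y := by linarith
  have hl0 : 0 < Real.log y := by linarith
  have hL1 : 1 < L := lt_of_lt_of_le (by linarith [Real.add_one_le_exp 2]) hL2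
  have hL0 : 0 < L := by linarith
  have hly : Real.log y = Real.exp L := (Real.exp_log hl0).symm
  have hy2 : 2 ≤ y := by linarith [Real.log_le_sub_one_of_pos hy0]
  rw [truncLog_eq_log hy2, ← hy] at hT
  have hT0 : 0 < T := (Real.rpow_pos_of_pos hy0 _).trans_le hT
  set u := Real.log T / Real.log y with hu
  have hlT : Real.log T = u * Real.log y := by rw [hu]; field_simp
  have huge : (1 + ε) * A * (L / Real.log L) ≤ u := by
    have h := Real.log_le_log (Real.rpow_pos_of_pos hy0 _) hT
    rw [Real.log_rpow hy0, ← le_div_iff₀ hl0, mul_div_assoc] at h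
    refine le_trans ?_ h
    gcongr
  obtain ⟨hu1, hmain⟩ := hexp u huge
  have hu0 : 0 < u := by linarith
  have hw0 : 0 < L ^ c := Real.rpow_pos_of_pos hL0 c
  set w := L ^ c with hw
  have hlw0 : 0 ≤ Real.log w := Real.log_nonneg (Real.one_le_rpow hL1.le hc0.le)
  have hlwL : Real.log w ≤ L := by
    rw [hw, Real.log_rpow hL0]
    nlinarith [Real.log_le_sub_one_of_pos hL0, Real.log_pos hL1]
  -- This makes `y ^ δ = w`; `δ ≤ 1 / 4` follows from `log w ≤ L` and `4 * L ≤ exp L = log y`.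
  set δ := Real.log w / Real.log y with hδ
  have hδ0 : 0 ≤ δ := by positivity
  have hδ4 : δ ≤ 1 / 4 := by rw [hδ, div_le_iff₀ hl0, hly]; linarith
  have hyδ : y ^ δ = w := by
    rw [Real.rpow_def_of_pos hy0, hδ, mul_div_cancel₀ _ hl0.ne', Real.exp_log hw0]
  have hyT : y ≤ T := by
    rw [← Real.log_le_log_iff hy0 hT0, hlT]; nlinarith
  have hcount := card_factoredNumbers_le (n := q - 1) (by omega) (y := y) (by rw [hy, hcast])
    hl1 hδ0 hδ4 hyT
  rw [hyδ] at hcount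
  have hlT2 : 2 ≤ Real.log T := by
    rw [hlT]
    have : 2 ≤ Real.log y := by
      rw [hly]; linarith [Real.add_one_le_exp L]
    nlinarith
  rw [truncLog_eq_log hlT2]
  have hden : Real.log T ^ A = Real.exp (A * (Real.log u + L)) := by
    rw [Real.rpow_def_of_pos (by linarith), hlT, Real.log_mul hu0.ne' hl0.ne', mul_comm]
  have hTδ : T ^ (1 - δ) = T * Real.exp (-(u * Real.log w)) := by
    rw [sub_eq_add_neg, Real.rpow_add hT0, Real.rpow_one, Real.rpow_def_of_pos hT0, hlT, hδ]
    congr 2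
    field_simp
  have hsum := sum_numIrreducibleBinomials_le (F := F) ⌊T⌋₊
  rw [hcard] at hsum
  refine hsum.trans ?_
  rw [mul_div_assoc]
  refine mul_le_mul_of_nonneg_left (hcount.trans ?_) (by linarith)
  rw [hTδ, hden, div_eq_mul_inv, ← Real.exp_neg, mul_assoc, ← Real.exp_add]
  refine mul_le_mul_of_nonneg_left (Real.exp_le_exp.mpr ?_) hT0.le
  linarith
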